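/- Let $\mathbb{k}$ be any field, let $1 \le m \le n$ be integers, let $S = \mathbb{k}[x_{ij} \mid 1\le i\le m,\ 1\le j\le n]$, and let $X = (x_{ij})$ be the generic $m\times n$ matrix. Let $\mathcal{D}$ be the graded dual of $S$, with $\mathbb{k}$-basis $\{\mathbf{X}^{\beta}\}$ dual to the monomials $\{\mathbf{x}^{\beta}\}$, considered as an $S$-module through the contraction action, i.e. the $\mathbb{k}$-bilinear extension of $\mathbf{x}^{\alpha}\circ \mathbf{X}^{\beta} = \mathbf{X}^{\beta-\alpha}$ if $\alpha\le\beta$ componentwise, and $0$ otherwise. Let $M\subseteq\mathcal{D}$ be the $S$-submodule generated by the maximal minors of $X$ (regarded as elements of $\mathcal{D}$ by replacing each monomial $\mathbf{x}^\beta$ with $\mathbf{X}^\beta$), and let $I = \mathrm{ann}_S(M) = \{f\in S \mid f\circ F = 0 \text{ for all } F\in M\}$ be its apolar ideal. Let $\mathcal{G}$ be the set consisting of the polynomials \begin{itemize} \item $x_{ik}^2$ for $1\le i\le m$, $1\le k\le n$; \item $x_{ik}x_{jk}$ for $1\le i,j\le m$, $1\le k\le n$, $i\ne j$; \item $x_{ik}x_{i\ell}$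 for $1\le i\le m$, $1\le k,\ell\le n$, $k\ne\ell$; \item $x_{ik}x_{j\ell}+x_{i\ell}x_{jk}$ for $1\le i,j\le m$, $1\le k,\ell\le n$, $i\ne j$, $k\ne \ell$. \end{itemize} Then $\mathcal{G}$ is a tidy revlex-universal Gröbner basis of quadrics for $I$, consisting of exactly $\binom{m+1}{2}\binom{n+1}{2}$ elements. That is: every element of $\mathcal{G}$ is a nonzero homogeneous polynomial of degree $2$ such that each variable divides at most one monomial of its support; $|\mathcal{G}| = \binom{m+1}{2}\binom{n+1}{2}$; and $\mathcal{G}$ is a Gröbner basis of $I$ with respect to the degree reverse lexicographic order attached to any total order of the variables $x_{ij}$. Moreover, $S/I$ is strongly Koszul with respect to the variables: $S/I$ is a standard graded $\mathbb{k}$-algebra, the residue classes $\overline{x}_{ij}$ form a $\mathbb{k}$-basis $B$ of $(S/I)_1$, and for every proper subset $A\subsetneq B$ and every $b\in B\setminus A$ the colon ideal $(a \mid a\in A) :_{S/I} b$ is generated by elements of $B$. -/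

import Mathlib

open MvPolynomial

/-! ### Degree reverse lexicographic orders -/

section RevLex

/-- The type of exponent vectors on `σ`, to be ordered reverse lexicographically by degree. -/
def DegRevLex (σ : Type*) := σ →₀ ℕ

noncomputable instance (σ : Type*) : AddCommMonoid (DegRevLex σ) :=
  inferInstanceAs (AddCommMonoid (σ →₀ ℕ))

/-- The sorting key of the degree reverse lexicographic order: first the total degree, then the
reverse of the lexicographic order in which the lowest variable is compared first. -/
noncomputable def DegRevLex.key {σ : Type*} (a : DegRevLex σ) : Lex (ℕ × (Lex (σ →₀ ℕ))ᵒᵈ) :=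
  toLex (Finsupp.degree (show σ →₀ ℕ from a), OrderDual.toDual (toLex (show σ →₀ ℕ from a)))

theorem DegRevLex.key_injective {σ : Type*} :
    Function.Injective (DegRevLex.key : DegRevLex σ → _) := by
  intro a b h
  have h2 := congrArg (fun z => (ofLex z).2) h
  exact h2

/-- The degree reverse lexicographic order. The linear order on `σ` is the order of the variables:
`i < j` means that the variable of index `i` is smaller than the variable of index `j`. -/
noncomputable instance (σ : Type*) [LinearOrder σ] : LinearOrder (DegRevLex σ) :=
  LinearOrder.lift' DegRevLex.key DegRevLex.key_injective

theorem DegRevLex.lt_iff {σ : Type*} [LinearOrder σ] (a b : σ →₀ ℕ) :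
    (show DegRevLex σ from a) < (show DegRevLex σ from b) ↔
      a.degree < b.degree ∨ a.degree = b.degree ∧ ∃ i, (∀ j, j < i → a j = b j) ∧ b i < a i := by
  change toLex (a.degree, OrderDual.toDual (toLex a)) <
    toLex (b.degree, OrderDual.toDual (toLex b)) ↔ _
  rw [Prod.Lex.toLex_lt_toLex]
  simp only [OrderDual.toDual_lt_toDual, Finsupp.Lex.lt_iff, eq_comm, ofLex_toLex]

theorem DegRevLex.le_iff {σ : Type*} [LinearOrder σ] (a b : σ →₀ ℕ) :
    (show DegRevLex σ from a) ≤ (show DegRevLex σ from b) ↔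
      a.degree < b.degree ∨ a.degree = b.degree ∧ toLex b ≤ toLex a := by
  change toLex (a.degree, OrderDual.toDual (toLex a)) ≤
    toLex (b.degree, OrderDual.toDual (toLex b)) ↔ _
  rw [Prod.Lex.toLex_le_toLex]
  simp only [OrderDual.toDual_le_toDual]

instance (σ : Type*) [LinearOrder σ] : IsOrderedAddMonoid (DegRevLex σ) where
  add_le_add_left a b h c := by
    have h' := (DegRevLex.le_iff a b).1 h
    refine (DegRevLex.le_iff (show σ →₀ ℕ from a + c) (show σ →₀ ℕ from b + c)).2 ?_
    have hd : ∀ x : σ →₀ ℕ, (x + (show σ →₀ ℕ from c)).degree =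
        x.degree + (show σ →₀ ℕ from c).degree := fun x => map_add Finsupp.degree x _
    have ha : (show σ →₀ ℕ from a + c) = (show σ →₀ ℕ from a) + (show σ →₀ ℕ from c) := rfl
    have hb : (show σ →₀ ℕ from b + c) = (show σ →₀ ℕ from b) + (show σ →₀ ℕ from c) := rfl
    rw [ha, hb, hd, hd, toLex_add, toLex_add]
    rcases h' with h1 | ⟨h1, h2⟩
    · exact Or.inl (Nat.add_lt_add_right h1 _)
    · exact Or.inr ⟨congrArg (· + _) h1, add_le_add_left h2 _⟩

instance (σ : Type*) [LinearOrder σ] [Finite σ] : WellFoundedLT (DegRevLex σ) := by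
  refine ⟨?_⟩
  have key : ∀ n : ℕ, {a : DegRevLex σ | Finsupp.degree (show σ →₀ ℕ from a) ≤ n}.Finite :=
    fun n => Finsupp.finite_of_degree_le n
  rw [← Set.wellFoundedOn_univ, Set.wellFoundedOn_iff_no_descending_seq]
  intro f hf
  refine Set.infinite_range_of_injective f.injective ((key (Finsupp.degree (show σ →₀ ℕ from f 0))).subset ?_)
  rintro _ ⟨k, rfl⟩
  have hle : f k ≤ f 0 := by
    rcases Nat.eq_zero_or_pos k with rfl | hk
    · exact le_rfl
    · exact le_of_lt (f.map_rel_iff.2 hk)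
  rcases (DegRevLex.le_iff _ _).1 hle with h | h
  · exact h.le
  · exact h.1.le

/-- The degree reverse lexicographic monomial order attached to a linear order of the (finitely
many) variables. -/
noncomputable def degRevLex {σ : Type*} [Finite σ] (ord : LinearOrder σ) : MonomialOrder σ where
  syn := DegRevLex σ
  toSyn := { toEquiv := Equiv.refl _, map_add' := fun _ _ => rfl }
  toSyn_monotone a b h := by
    refine (DegRevLex.le_iff a b).2 ?_
    rcases eq_or_ne a b with rfl | hne
    · exact Or.inr ⟨rfl, le_rfl⟩
    · left
      obtain ⟨c, rfl⟩ := exists_add_of_le h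
      have hc : c ≠ 0 := fun h0 => hne (by simp [h0])
      have : c.degree ≠ 0 := fun h0 => hc ((Finsupp.degree_eq_zero_iff c).1 h0)
      rw [map_add]
      omega

open scoped MonomialOrder in
/-- `x^a < x^b` if and only if `x^a` has smaller degree, or the degrees agree and, at the lowest
variable at which the exponents differ, `a` has the larger exponent. -/
theorem degRevLex_lt_iff {σ : Type*} [Finite σ] (ord : LinearOrder σ) (a b : σ →₀ ℕ) :
    a ≺[degRevLex ord] b ↔
      a.degree < b.degree ∨ a.degree = b.degree ∧ ∃ i, (∀ j, j < i → a j = b j) ∧ b i < a i :=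
  DegRevLex.lt_iff a b

end RevLex

/-! ### Gröbner bases, tidy polynomials -/

section Groebner

variable {σ k : Type*} [Field k]

/-- `G` is a Gröbner basis of the ideal `I` for the monomial order `ord`. -/
def IsGroebnerBasis (ord : MonomialOrder σ) (G : Set (MvPolynomial σ k))
    (I : Ideal (MvPolynomial σ k)) : Prop :=
  G.Finite ∧ G ⊆ I ∧
    Ideal.span (ord.leadingTerm '' (I : Set (MvPolynomial σ k))) = Ideal.span (ord.leadingTerm '' G)

/-- A revlex-universal Gröbner basis: a Gröbner basis with respect to the degree reverse
lexicographic order attached to any total order of the variables. -/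
def IsRevLexUniversalGroebnerBasis [Finite σ] (G : Set (MvPolynomial σ k))
    (I : Ideal (MvPolynomial σ k)) : Prop :=
  ∀ ord : LinearOrder σ, IsGroebnerBasis (degRevLex ord) G I

/-- A homogeneous polynomial is tidy if each variable divides at most one monomial of its
support. -/
def IsTidy (f : MvPolynomial σ k) : Prop :=
  (∃ d : ℕ, f.IsHomogeneous d) ∧
    ∀ i : σ, ∀ a ∈ f.support, ∀ b ∈ f.support, a i ≠ 0 → b i ≠ 0 → a = b

/-- A quadric: a nonzero homogeneous polynomial of degree two. -/
def IsQuadric (f : MvPolynomial σ k) : Prop :=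
  f ≠ 0 ∧ f.IsHomogeneous 2

end Groebner

/-! ### Macaulay's inverse system -/

section InverseSystem

/-- The graded dual of `k[x_i | i ∈ σ]` (the underlying module of the divided power algebra): the
`k`-vector space with basis the symbols `X^β`, `β` an exponent vector, `X^β` being dual to `x^β`. -/
def GradedDual (σ k : Type*) [Field k] := (σ →₀ ℕ) →₀ k

variable {σ k : Type*} [Field k]

noncomputable instance : AddCommGroup (GradedDual σ k) :=
  inferInstanceAs (AddCommGroup ((σ →₀ ℕ) →₀ k))

noncomputable instance : Module k (GradedDual σ k) :=
  inferInstanceAs (Module k ((σ →₀ ℕ) →₀ k))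

/-- The element `c • X^β` of the graded dual. -/
noncomputable def GradedDual.monomial (β : σ →₀ ℕ) : k →ₗ[k] GradedDual σ k :=
  (Finsupp.lsingle β : k →ₗ[k] ((σ →₀ ℕ) →₀ k))

theorem GradedDual.hom_ext {V : Type*} [AddCommMonoid V] [Module k V]
    {f g : GradedDual σ k →ₗ[k] V}
    (h : ∀ β, f (GradedDual.monomial β 1) = g (GradedDual.monomial β 1)) : f = g := by
  have : ∀ f' g' : ((σ →₀ ℕ) →₀ k) →ₗ[k] V,
      (∀ β, f' (Finsupp.single β 1) = g' (Finsupp.single β 1)) → f' = g' := by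
    intro f' g' h'
    refine Finsupp.lhom_ext' fun β => LinearMap.ext_ring ?_
    simpa using h' β
  exact this f g h

open Classical in
/-- Contraction by the monomial `x^α`: it sends `X^β` to `X^(β - α)` if `α ≤ β` componentwise, and
to `0` otherwise. -/
noncomputable def GradedDual.contract (α : σ →₀ ℕ) : Module.End k (GradedDual σ k) :=
  (Finsupp.lsum k fun β : σ →₀ ℕ =>
    if α ≤ β then (GradedDual.monomial (β - α) : k →ₗ[k] GradedDual σ k) else 0 :
    ((σ →₀ ℕ) →₀ k) →ₗ[k] GradedDual σ k)

open Classical in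
theorem GradedDual.contract_monomial (α β : σ →₀ ℕ) (c : k) :
    GradedDual.contract α (GradedDual.monomial β c) =
      if α ≤ β then GradedDual.monomial (β - α) c else 0 := by
  have : GradedDual.contract α (GradedDual.monomial β c) =
      (if α ≤ β then (GradedDual.monomial (β - α) : k →ₗ[k] GradedDual σ k) else 0) c :=
    Finsupp.lsum_single (S := k) (M := k) (N := GradedDual σ k) (R := k) _ β c
  rw [this]
  split_ifs <;> rfl

/-- Contraction by monomials is multiplicative. -/
noncomputable def GradedDual.contractHom :
    Multiplicative (σ →₀ ℕ) →* Module.End k (GradedDual σ k) where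
  toFun α := GradedDual.contract α.toAdd
  map_one' := by
    refine GradedDual.hom_ext fun β => ?_
    simp [GradedDual.contract_monomial]
  map_mul' α α' := by
    refine GradedDual.hom_ext fun β => ?_
    rw [Module.End.mul_apply, GradedDual.contract_monomial, GradedDual.contract_monomial]
    by_cases h : α'.toAdd ≤ β
    · rw [if_pos h, GradedDual.contract_monomial, toAdd_mul]
      have hiff : α.toAdd + α'.toAdd ≤ β ↔ α.toAdd ≤ β - α'.toAdd :=
        (le_tsub_iff_right h).symm
      by_cases h2 : α.toAdd ≤ β - α'.toAdd
      · rw [if_pos h2, if_pos (hiff.2 h2), tsub_tsub, add_comm]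
      · rw [if_neg h2, if_neg (fun h3 => h2 (hiff.1 h3))]
    · rw [if_neg h, map_zero, toAdd_mul,
        if_neg (fun h3 => h (le_trans (le_add_of_nonneg_left zero_le) h3))]

/-- The contraction action of the polynomial ring on its graded dual, as an algebra homomorphism:
the `k`-linear extension of the contraction by monomials. -/
noncomputable def GradedDual.contraction :
    MvPolynomial σ k →ₐ[k] Module.End k (GradedDual σ k) :=
  AddMonoidAlgebra.lift k (Module.End k (GradedDual σ k)) (σ →₀ ℕ) GradedDual.contractHom

/-- The graded dual is a module over the polynomial ring through the contraction action. -/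
noncomputable instance : Module (MvPolynomial σ k) (GradedDual σ k) :=
  Module.compHom (GradedDual σ k)
    (GradedDual.contraction : MvPolynomial σ k →ₐ[k] _).toRingHom

open Classical in
theorem GradedDual.monomial_smul_monomial (α β : σ →₀ ℕ) (c d : k) :
    (MvPolynomial.monomial α c) • (GradedDual.monomial β d : GradedDual σ k) =
      if α ≤ β then GradedDual.monomial (β - α) (c * d) else 0 := by
  have h : (MvPolynomial.monomial α c) • (GradedDual.monomial β d : GradedDual σ k) =
      (GradedDual.contraction (MvPolynomial.monomial α c)) (GradedDual.monomial β d) := rfl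
  have h2 : (GradedDual.contraction (MvPolynomial.monomial α c) : Module.End k (GradedDual σ k)) =
      c • GradedDual.contract α :=
    AddMonoidAlgebra.lift_single (R := k) (A := Module.End k (GradedDual σ k)) _ α c
  rw [h, h2, LinearMap.smul_apply, GradedDual.contract_monomial]
  split_ifs
  · rw [← map_smul, smul_eq_mul]
  · exact smul_zero c

/-- The identification of polynomials with elements of the graded dual that sends each monomial
`x^β` to the dual basis element `X^β`. -/
noncomputable def GradedDual.ofPoly : MvPolynomial σ k ≃ₗ[k] GradedDual σ k :=
  ((MvPolynomial.basisMonomials σ k).repr : MvPolynomial σ k ≃ₗ[k] ((σ →₀ ℕ) →₀ k))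

theorem GradedDual.ofPoly_monomial (β : σ →₀ ℕ) (c : k) :
    GradedDual.ofPoly (MvPolynomial.monomial β c) = GradedDual.monomial β c := by
  have h : (MvPolynomial.monomial β c : MvPolynomial σ k) =
      c • MvPolynomial.basisMonomials σ k β := by
    simp [MvPolynomial.coe_basisMonomials, MvPolynomial.smul_monomial]
  rw [h, map_smul]
  have h2 : GradedDual.ofPoly (MvPolynomial.basisMonomials σ k β) = GradedDual.monomial β (1 : k) :=
    (MvPolynomial.basisMonomials σ k).repr_self β
  rw [h2, ← map_smul, smul_eq_mul, mul_one]

end InverseSystem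

/-! ### Strongly Koszul algebras -/

section StronglyKoszul

variable (k : Type*) {R : Type*} [Field k] [CommRing R] [Algebra k R]

/-- The family `𝒜` of subspaces makes `R` a standard graded `k`-algebra: it is an algebra grading,
the degree-zero part is a copy of `k`, and `R` is generated over `k` by the degree-one part, which
has finite dimension. -/
structure IsStandardGraded (𝒜 : ℕ → Submodule k R) : Prop where
  gradedMonoid : SetLike.GradedMonoid 𝒜
  isInternal : DirectSum.IsInternal 𝒜
  injective : Function.Injective (algebraMap k R)
  degree_zero : 𝒜 0 = 1
  finite : Module.Finite k (𝒜 1)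
  generated : Algebra.adjoin k (𝒜 1 : Set R) = ⊤

/-- `R`, graded by `𝒜`, is strongly Koszul with respect to the basis `b` of its degree-one part:
every colon ideal `(b j | j ∈ A) : b i` with `i ∉ A` is generated by elements of the basis. -/
structure IsStronglyKoszul (𝒜 : ℕ → Submodule k R) {ι : Type*} (b : ι → R) : Prop where
  standardGraded : IsStandardGraded k 𝒜
  linearIndependent : LinearIndependent k b
  span_eq : Submodule.span k (Set.range b) = 𝒜 1
  colon_eq : ∀ (A : Set ι) (i : ι), i ∉ A →
    ∃ C : Set ι, (Ideal.span (b '' A)).colon {b i} = Ideal.span (b '' C)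

/-- The degree-`d` part of the quotient of a polynomial ring by an ideal: the classes of the
homogeneous polynomials of degree `d`. -/
noncomputable def quotientGrading {σ k : Type*} [Field k] (I : Ideal (MvPolynomial σ k)) (d : ℕ) :
    Submodule k (MvPolynomial σ k ⧸ I) :=
  (MvPolynomial.homogeneousSubmodule σ k d).map (Ideal.Quotient.mkₐ k I).toLinearMap

end StronglyKoszul

/-! ### The generic matrix -/

section Generic

variable (k : Type*) [Field k] (m n : ℕ)

/-- The maximal minor of the generic `m × n` matrix `(x_{ij})` (with `m ≤ n`) on the columns
`J 0 < J 1 < ⋯`. -/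
noncomputable def maximalMinor (J : Fin m ↪o Fin n) : MvPolynomial (Fin m × Fin n) k :=
  ((Matrix.mvPolynomialX (Fin m) (Fin n) k).submatrix id J).det

/-- The submodule, for the contraction action, generated by the maximal minors of the generic
`m × n` matrix. -/
noncomputable def maximalMinorModule :
    Submodule (MvPolynomial (Fin m × Fin n) k) (GradedDual (Fin m × Fin n) k) :=
  Submodule.span _ (Set.range fun J : Fin m ↪o Fin n => GradedDual.ofPoly (maximalMinor k m n J))

/-- The apolar ideal of the module generated by the maximal minors of the generic matrix. -/
noncomputable def maximalMinorApolarIdeal : Ideal (MvPolynomial (Fin m × Fin n) k) :=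
  (maximalMinorModule k m n).annihilator

/-- The squares `x_{ik}^2`, the products `x_{ik} x_{jk}` (`i ≠ j`) and `x_{ik} x_{il}` (`k ≠ l`),
and the binomials `x_{ik} x_{jl} + x_{il} x_{jk}` (`i ≠ j`, `k ≠ l`). -/
def genericQuadrics : Set (MvPolynomial (Fin m × Fin n) k) :=
  {f | ∃ i p, f = X (i, p) ^ 2} ∪
  {f | ∃ i j p, i ≠ j ∧ f = X (i, p) * X (j, p)} ∪
  {f | ∃ i p q, p ≠ q ∧ f = X (i, p) * X (i, q)} ∪
  {f | ∃ i j p q, i ≠ j ∧ p ≠ q ∧ f = X (i, p) * X (j, q) + X (i, q) * X (j, p)}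

end Generic

/-! Give `x_{ij}` the multidegree (row `i`, column `j`). All terms of one maximal minor share a
multidegree and use each row and each column at most once, so every monomial that is not a matching
lies in `I`. A matching `a` extends to the graph of an injective map, that is, to a term of some
minor. Contracting that minor and reading off the coefficient at the complement of `a` gives a
functional that kills `I`, is nonzero on `x^a`, and vanishes on monomials of other multidegrees
(`IsMatchingExponent.exists_functional`). Conversely, the binomial quadrics exchange columns between
two rows, so monomials of equal multidegree are proportional modulo `I`. Thus `S/I` is
one-dimensional in each matching multidegree and zero in the others.

Gröbner basis: a monomial divisible by no leading monomial of a quadric is a matching and the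
smallest monomial of its multidegree (`not_lt_of_not_degree_le`). If it were the leading monomial of
a nonzero `f ∈ I`, its functional would see only the leading term of `f`, a contradiction.

Strong Koszulness: the colon by `x_{st}` is generated by the variables whose product with `x_{st}`
lies in the ideal (`mul_X_mem_span_X_sup_iff`). A surviving monomial of a normal form, multiplied by
`x_{st}`, is a matching whose functional kills the whole ideal. -/

/-! ### Coefficients of contractions -/

section Contraction

variable {σ k : Type*} [Field k]

/-- The coefficient of `X^γ` in an element of the graded dual. -/
noncomputable def GradedDual.coeff (γ : σ →₀ ℕ) : GradedDual σ k →ₗ[k] k :=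
  (Finsupp.lapply γ : ((σ →₀ ℕ) →₀ k) →ₗ[k] k)

theorem GradedDual.eq_zero_iff (F : GradedDual σ k) : F = 0 ↔ ∀ γ, GradedDual.coeff γ F = 0 :=
  ⟨fun h γ => by rw [h, map_zero], fun h => Finsupp.ext (f := F) (g := 0) h⟩

open Classical in
theorem GradedDual.coeff_monomial (γ β : σ →₀ ℕ) (c : k) :
    GradedDual.coeff γ (GradedDual.monomial β c) = if β = γ then c else 0 :=
  Finsupp.single_apply

/-- The linear functional sending `f` to the coefficient of `X^γ` in `f ∘ F`. -/
noncomputable def contractCoeff (F : MvPolynomial σ k) (γ : σ →₀ ℕ) : MvPolynomial σ k →ₗ[k] k :=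
  GradedDual.coeff γ ∘ₗ LinearMap.applyₗ (GradedDual.ofPoly F) ∘ₗ
    (GradedDual.contraction : MvPolynomial σ k →ₐ[k] _).toLinearMap

theorem contractCoeff_apply (F : MvPolynomial σ k) (γ : σ →₀ ℕ) (f : MvPolynomial σ k) :
    contractCoeff F γ f = GradedDual.coeff γ (f • GradedDual.ofPoly F) := rfl

/-- Contraction by `x^α` sends `X^β` to `X^γ` exactly when `β = α + γ`. Membership in the apolar
ideal thereby becomes a family of linear conditions on coefficients. -/
theorem contractCoeff_monomial (F : MvPolynomial σ k) (γ α : σ →₀ ℕ) (c : k) :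
    contractCoeff F γ (monomial α c) = c * F.coeff (α + γ) := by
  classical
  have key : ∀ β b, GradedDual.coeff γ (monomial α c • GradedDual.ofPoly (monomial β b)) =
      c * (monomial β b).coeff (α + γ) := by
    intro β b
    rw [GradedDual.ofPoly_monomial, GradedDual.monomial_smul_monomial, MvPolynomial.coeff_monomial]
    by_cases hle : α ≤ β
    · rw [if_pos hle, GradedDual.coeff_monomial]
      have : β - α = γ ↔ β = α + γ := by
        rw [tsub_eq_iff_eq_add_of_le hle, add_comm]
      simp [this]
    · rw [if_neg hle, if_neg (fun h : β = α + γ => hle (h ▸ le_self_add)), map_zero, mul_zero]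
  rw [contractCoeff_apply]
  induction F using MvPolynomial.induction_on' with
  | monomial β b => exact key β b
  | add p q hp hq => rw [map_add, smul_add, map_add, hp, hq, coeff_add, mul_add]

theorem smul_ofPoly_eq_zero_iff (F f : MvPolynomial σ k) :
    f • GradedDual.ofPoly F = 0 ↔ ∀ γ, contractCoeff F γ f = 0 :=
  GradedDual.eq_zero_iff _

end Contraction

/-! ### Row and column degrees -/

section Multidegree

variable {ι κ : Type*}

/-- The row degree of an exponent vector. -/
noncomputable def rowDeg : ((ι × κ) →₀ ℕ) →+ (ι →₀ ℕ) := Finsupp.mapDomain.addMonoidHom Prod.fst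

/-- The column degree of an exponent vector. -/
noncomputable def colDeg : ((ι × κ) →₀ ℕ) →+ (κ →₀ ℕ) := Finsupp.mapDomain.addMonoidHom Prod.snd

/-- The pair of row and column degrees of an exponent vector. -/
noncomputable def multideg : ((ι × κ) →₀ ℕ) →+ (ι →₀ ℕ) × (κ →₀ ℕ) := rowDeg.prod colDeg

@[simp] theorem rowDeg_single (v : ι × κ) (c : ℕ) :
    rowDeg (Finsupp.single v c) = Finsupp.single v.1 c := Finsupp.mapDomain_single

@[simp] theorem colDeg_single (v : ι × κ) (c : ℕ) :
    colDeg (Finsupp.single v c) = Finsupp.single v.2 c := Finsupp.mapDomain_single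

theorem multideg_eq_iff (a b : (ι × κ) →₀ ℕ) :
    multideg a = multideg b ↔ rowDeg a = rowDeg b ∧ colDeg a = colDeg b := Prod.ext_iff

theorem degree_rowDeg (a : (ι × κ) →₀ ℕ) : (rowDeg a).degree = a.degree := by
  induction a using Finsupp.induction_linear with
  | zero => simp
  | add f g hf hg => rw [map_add, map_add, map_add, hf, hg]
  | single v c => simp

theorem degree_eq_of_multideg_eq {a b : (ι × κ) →₀ ℕ} (h : multideg a = multideg b) :
    a.degree = b.degree := by
  rw [← degree_rowDeg, ((multideg_eq_iff a b).1 h).1, degree_rowDeg]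

theorem exists_of_rowDeg_ne_zero {a : (ι × κ) →₀ ℕ} {i : ι} (h : rowDeg a i ≠ 0) :
    ∃ j, a (i, j) ≠ 0 := by
  classical
  obtain ⟨v, hv, rfl⟩ := Finset.mem_image.1 (Finsupp.mapDomain_support (Finsupp.mem_support_iff.2 h))
  exact ⟨v.2, Finsupp.mem_support_iff.1 hv⟩

theorem exists_of_colDeg_ne_zero {a : (ι × κ) →₀ ℕ} {j : κ} (h : colDeg a j ≠ 0) :
    ∃ i, a (i, j) ≠ 0 := by
  classical
  obtain ⟨v, hv, rfl⟩ := Finset.mem_image.1 (Finsupp.mapDomain_support (Finsupp.mem_support_iff.2 h))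
  exact ⟨v.1, Finsupp.mem_support_iff.1 hv⟩

theorem exists_eq_single_add {σ : Type*} {a : σ →₀ ℕ} {v : σ} (h : a v ≠ 0) :
    ∃ b, a = Finsupp.single v 1 + b :=
  exists_add_of_le (Finsupp.single_le_iff.2 (Nat.one_le_iff_ne_zero.2 h))

theorem exists_eq_single_add_single_add {σ : Type*} {a : σ →₀ ℕ} {v w : σ} (hvw : v ≠ w)
    (hv : a v ≠ 0) (hw : a w ≠ 0) :
    ∃ b, a = Finsupp.single v 1 + Finsupp.single w 1 + b := by
  obtain ⟨b, rfl⟩ := exists_eq_single_add hv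
  have : b w ≠ 0 := by simpa [Finsupp.single_apply, hvw] using hw
  obtain ⟨c, rfl⟩ := exists_eq_single_add this
  exact ⟨c, (add_assoc _ _ _).symm⟩

theorem rowDeg_ne_zero {a : (ι × κ) →₀ ℕ} {v : ι × κ} (h : a v ≠ 0) : rowDeg a v.1 ≠ 0 := by
  obtain ⟨b, rfl⟩ := exists_eq_single_add h
  simp

theorem colDeg_ne_zero {a : (ι × κ) →₀ ℕ} {v : ι × κ} (h : a v ≠ 0) : colDeg a v.2 ≠ 0 := by
  obtain ⟨b, rfl⟩ := exists_eq_single_add h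
  simp

/-- Exponent vectors of monomials with at most one variable from each row and each column. -/
def IsMatchingExponent (a : (ι × κ) →₀ ℕ) : Prop :=
  (∀ i, rowDeg a i ≤ 1) ∧ ∀ j, colDeg a j ≤ 1

theorem IsMatchingExponent.of_add_left {a b : (ι × κ) →₀ ℕ} (h : IsMatchingExponent (a + b)) :
    IsMatchingExponent a := by
  refine ⟨fun i => le_trans ?_ (h.1 i), fun j => le_trans ?_ (h.2 j)⟩ <;> simp

theorem IsMatchingExponent.snd_eq {a : (ι × κ) →₀ ℕ} (h : IsMatchingExponent a) {i : ι} {p q : κ}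
    (hp : a (i, p) ≠ 0) (hq : a (i, q) ≠ 0) : p = q := by
  by_contra hne
  obtain ⟨b, rfl⟩ := exists_eq_single_add_single_add (by simpa using hne) hp hq
  have := h.1 i
  simp at this
  omega

theorem IsMatchingExponent.fst_eq {a : (ι × κ) →₀ ℕ} (h : IsMatchingExponent a) {i j : ι} {p : κ}
    (hi : a (i, p) ≠ 0) (hj : a (j, p) ≠ 0) : i = j := by
  by_contra hne
  obtain ⟨b, rfl⟩ := exists_eq_single_add_single_add (by simpa using hne) hi hj
  have := h.2 p
  simp at this
  omega

theorem IsMatchingExponent.apply_le_one {a : (ι × κ) →₀ ℕ} (h : IsMatchingExponent a) (v : ι × κ) :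
    a v ≤ 1 := by
  by_contra hlt
  have h2 : 2 ≤ a v := Nat.lt_of_not_le hlt
  obtain ⟨b, rfl⟩ := exists_add_of_le (Finsupp.single_le_iff.2 h2)
  have := h.1 v.1
  simp at this
  omega

theorem IsMatchingExponent.eq_zero_or_eq_one {a : (ι × κ) →₀ ℕ} (h : IsMatchingExponent a)
    (v : ι × κ) : a v = 0 ∨ a v = 1 := Nat.le_one_iff_eq_zero_or_eq_one.1 (h.apply_le_one v)

theorem IsMatchingExponent.of_multideg_eq {a b : (ι × κ) →₀ ℕ} (h : IsMatchingExponent a)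
    (hab : multideg a = multideg b) : IsMatchingExponent b := by
  obtain ⟨h1, h2⟩ := (multideg_eq_iff a b).1 hab
  exact ⟨h1 ▸ h.1, h2 ▸ h.2⟩

/-- An exponent vector that is not a matching is divisible by a quadratic one of the same kind. -/
theorem exists_of_not_isMatchingExponent {a : (ι × κ) →₀ ℕ} (h : ¬ IsMatchingExponent a) :
    ∃ v w : ι × κ, (v.1 = w.1 ∨ v.2 = w.2) ∧
      ∃ b, a = Finsupp.single v 1 + Finsupp.single w 1 + b := by
  rw [IsMatchingExponent, not_and_or, not_forall, not_forall] at h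
  rcases h with ⟨i, hlt⟩ | ⟨j, hlt⟩
  · have h2 : 2 ≤ rowDeg a i := Nat.lt_of_not_le hlt
    obtain ⟨p, hp⟩ := exists_of_rowDeg_ne_zero (Nat.ne_zero_of_lt h2)
    obtain ⟨b, rfl⟩ := exists_eq_single_add hp
    rw [map_add, rowDeg_single, Finsupp.add_apply, Finsupp.single_eq_same] at h2
    obtain ⟨q, hq⟩ := exists_of_rowDeg_ne_zero (a := b) (i := i) (by omega)
    obtain ⟨c, rfl⟩ := exists_eq_single_add hq
    exact ⟨(i, p), (i, q), Or.inl rfl, c, (add_assoc _ _ _).symm⟩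
  · have h2 : 2 ≤ colDeg a j := Nat.lt_of_not_le hlt
    obtain ⟨p, hp⟩ := exists_of_colDeg_ne_zero (Nat.ne_zero_of_lt h2)
    obtain ⟨b, rfl⟩ := exists_eq_single_add hp
    rw [map_add, colDeg_single, Finsupp.add_apply, Finsupp.single_eq_same] at h2
    obtain ⟨q, hq⟩ := exists_of_colDeg_ne_zero (a := b) (j := j) (by omega)
    obtain ⟨c, rfl⟩ := exists_eq_single_add hq
    exact ⟨(p, j), (q, j), Or.inr rfl, c, (add_assoc _ _ _).symm⟩

/-! ### Graphs of maps from rows to columns, and completion of matchings. -/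

variable [Fintype ι]

/-- The exponent vector of the monomial supported on the graph of `f`. -/
noncomputable def graphExponent (f : ι → κ) : (ι × κ) →₀ ℕ := ∑ i, Finsupp.single (i, f i) 1

theorem graphExponent_apply [DecidableEq κ] (f : ι → κ) (v : ι × κ) :
    graphExponent f v = if f v.1 = v.2 then 1 else 0 := by
  classical
  rw [graphExponent, Finsupp.finsetSum_apply, Finset.sum_eq_single v.1]
  · simp [Finsupp.single_apply, Prod.ext_iff]
  · intro i _ hi
    simp [Prod.ext_iff, hi]
  · simp

theorem graphExponent_injective : Function.Injective (graphExponent : (ι → κ) → _) := by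
  classical
  intro f g h
  funext i
  have := DFunLike.congr_fun h (i, g i)
  simpa [graphExponent_apply] using this

theorem rowDeg_graphExponent (f : ι → κ) : rowDeg (graphExponent f) = ∑ i, Finsupp.single i 1 := by
  simp [graphExponent]

theorem colDeg_graphExponent (f : ι → κ) :
    colDeg (graphExponent f) = ∑ i, Finsupp.single (f i) 1 := by
  simp [graphExponent]

theorem multideg_graphExponent_comp (f : ι → κ) (s t : Equiv.Perm ι) :
    multideg (graphExponent (f ∘ s)) = multideg (graphExponent (f ∘ t)) := by
  rw [multideg_eq_iff, rowDeg_graphExponent, rowDeg_graphExponent, colDeg_graphExponent,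
    colDeg_graphExponent]
  refine ⟨rfl, ?_⟩
  exact (Equiv.sum_comp s fun i => Finsupp.single (f i) 1).trans
    (Equiv.sum_comp t fun i => Finsupp.single (f i) 1).symm

theorem isMatchingExponent_graphExponent {f : ι → κ} (hf : Function.Injective f) :
    IsMatchingExponent (graphExponent f) := by
  classical
  by_contra h
  obtain ⟨v, w, hvw, b, hb⟩ := exists_of_not_isMatchingExponent h
  have hv : graphExponent f v ≠ 0 := by rw [hb]; simp
  have hw : graphExponent f w ≠ 0 := by rw [hb]; simp
  rw [graphExponent_apply] at hv hw
  have hv : f v.1 = v.2 := by simpa using hv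
  have hw : f w.1 = w.2 := by simpa using hw
  have heq : v = w := by
    rcases hvw with h1 | h2
    · exact Prod.ext h1 (by rw [← hv, ← hw, h1])
    · exact Prod.ext (hf (by rw [hv, hw, h2])) h2
  subst heq
  have := DFunLike.congr_fun hb v
  rw [graphExponent_apply, if_pos hv] at this
  simp at this
  omega

/-- Only the rows `i` and `j` change. The relation is additive, which avoids truncated subtraction.
-/
theorem graphExponent_comp_swap [DecidableEq ι] (f : ι → κ) {i j : ι} (hij : i ≠ j) :
    graphExponent (f ∘ Equiv.swap i j) + (Finsupp.single (i, f i) 1 + Finsupp.single (j, f j) 1) =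
      graphExponent f + (Finsupp.single (i, f j) 1 + Finsupp.single (j, f i) 1) := by
  classical
  have key : ∀ g : ι → κ, graphExponent g =
      Finsupp.single (i, g i) 1 + Finsupp.single (j, g j) 1 +
        ∑ x ∈ Finset.univ \ {i, j}, Finsupp.single (x, g x) 1 := by
    intro g
    rw [graphExponent, ← Finset.sum_sdiff (Finset.subset_univ {i, j}), Finset.sum_pair hij,
      add_comm]
  have hrest : ∑ x ∈ Finset.univ \ {i, j}, Finsupp.single (x, (f ∘ Equiv.swap i j) x) 1 =
      ∑ x ∈ Finset.univ \ {i, j}, Finsupp.single (x, f x) 1 := by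
    refine Finset.sum_congr rfl fun x hx => ?_
    simp only [Finset.mem_sdiff, Finset.mem_insert, Finset.mem_singleton, not_or] at hx
    rw [Function.comp_apply, Equiv.swap_apply_of_ne_of_ne hx.2.1 hx.2.2]
  rw [key (f ∘ Equiv.swap i j), key f, hrest]
  simp only [Function.comp_apply, Equiv.swap_apply_left, Equiv.swap_apply_right]
  abel

/-- A matching is the graph of an injective map on the set `s` of rows that it meets. Its image is
enlarged to as many columns as there are rows, and the map extends to a bijection onto that set. -/
theorem IsMatchingExponent.exists_le_graphExponent [Fintype κ] [Nonempty κ]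
    (hcard : Fintype.card ι ≤ Fintype.card κ) {a : (ι × κ) →₀ ℕ} (ha : IsMatchingExponent a) :
    ∃ f : ι → κ, Function.Injective f ∧ a ≤ graphExponent f := by
  classical
  let f₀ : ι → κ := fun i => if h : ∃ j, a (i, j) ≠ 0 then h.choose else Classical.arbitrary κ
  have hf₀ : ∀ i j, a (i, j) ≠ 0 → f₀ i = j := by
    intro i j hj
    have h : ∃ j, a (i, j) ≠ 0 := ⟨j, hj⟩
    simp only [f₀, dif_pos h]
    exact ha.snd_eq h.choose_spec hj
  let s : Finset ι := {i | ∃ j, a (i, j) ≠ 0}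
  have hs : ∀ i ∈ s, a (i, f₀ i) ≠ 0 := by
    intro i hi
    obtain ⟨j, hj⟩ := (Finset.mem_filter.1 hi).2
    rwa [hf₀ i j hj]
  have hinj : Set.InjOn f₀ s := by
    intro i hi j hj hij
    have h1 := hs i hi
    rw [hij] at h1
    exact ha.fst_eq h1 (hs j hj)
  obtain ⟨t, hst, ht⟩ := Finset.exists_superset_card_eq (s := s.image f₀) (n := Fintype.card ι)
    (Finset.card_image_le.trans (Finset.card_le_univ s)) hcard
  obtain ⟨g, hg⟩ := Finset.exists_equiv_extend_of_card_eq ht.symm hst hinj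
  refine ⟨fun i => g i, fun i j hij => g.injective (Subtype.ext hij), fun v => ?_⟩
  rw [graphExponent_apply]
  rcases ha.eq_zero_or_eq_one v with h0 | h1
  · rw [h0]; exact Nat.zero_le _
  · have hv : a (v.1, v.2) ≠ 0 := by simp [h1]
    have : v.1 ∈ s := Finset.mem_filter.2 ⟨Finset.mem_univ _, v.2, hv⟩
    rw [hg _ this, hf₀ _ _ hv, if_pos rfl, h1]

end Multidegree

/-! ### The apolar ideal of the maximal minors -/

section Apolar

variable {k : Type*} [Field k] {m n : ℕ}

theorem maximalMinor_eq_sum (J : Fin m ↪o Fin n) :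
    maximalMinor k m n J =
      ∑ s : Equiv.Perm (Fin m), monomial (graphExponent (J ∘ s)) ((s.sign : ℤ) : k) := by
  rw [maximalMinor, ← Matrix.det_transpose, Matrix.det_apply']
  refine Finset.sum_congr rfl fun s _ => ?_
  have h : ∏ i, ((Matrix.mvPolynomialX (Fin m) (Fin n) k).submatrix id J).transpose (s i) i =
      monomial (graphExponent (J ∘ s)) 1 := by
    rw [graphExponent, monomial_sum_one]
    rfl
  rw [h, ← map_intCast (C : k →+* MvPolynomial (Fin m × Fin n) k), C_mul_monomial, mul_one]

theorem coeff_maximalMinor (J : Fin m ↪o Fin n) (δ : (Fin m × Fin n) →₀ ℕ) :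
    (maximalMinor k m n J).coeff δ =
      ∑ s : Equiv.Perm (Fin m), if graphExponent (J ∘ s) = δ then ((s.sign : ℤ) : k) else 0 := by
  classical
  simp only [maximalMinor_eq_sum, coeff_sum, coeff_monomial]

theorem exists_of_coeff_maximalMinor_ne_zero {J : Fin m ↪o Fin n} {δ : (Fin m × Fin n) →₀ ℕ}
    (h : (maximalMinor k m n J).coeff δ ≠ 0) :
    ∃ s : Equiv.Perm (Fin m), graphExponent (J ∘ s) = δ := by
  rw [coeff_maximalMinor] at h
  obtain ⟨s, -, hs⟩ := Finset.exists_ne_zero_of_sum_ne_zero h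
  exact ⟨s, by_contra fun hne => hs (if_neg hne)⟩

/-- Distinct permutations give distinct monomials, so nothing cancels: the coefficient is a sign,
nonzero in every characteristic. -/
theorem coeff_maximalMinor_graphExponent_ne_zero (J : Fin m ↪o Fin n) (s : Equiv.Perm (Fin m)) :
    (maximalMinor k m n J).coeff (graphExponent (J ∘ s)) ≠ 0 := by
  rw [coeff_maximalMinor, Finset.sum_eq_single s]
  · rw [if_pos rfl]
    rcases Int.units_eq_one_or s.sign with h | h <;> simp [h]
  · intro t _ hts
    refine if_neg fun h => hts (Equiv.ext fun x => J.injective ?_)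
    exact congrFun (graphExponent_injective h) x
  · simp

theorem coeff_maximalMinor_eq_zero {J : Fin m ↪o Fin n} {δ : (Fin m × Fin n) →₀ ℕ}
    (h : ¬ IsMatchingExponent δ) : (maximalMinor k m n J).coeff δ = 0 := by
  by_contra h0
  obtain ⟨s, rfl⟩ := exists_of_coeff_maximalMinor_ne_zero h0
  exact h (isMatchingExponent_graphExponent (J.injective.comp s.injective))

/-- Composing with the transposition of `i` and `j` matches the permutations contributing to the two
coefficients and reverses their signs. This puts the binomial quadrics in the apolar ideal. -/
theorem coeff_maximalMinor_swap (J : Fin m ↪o Fin n) {i j : Fin m} {p q : Fin n} (hij : i ≠ j)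
    (γ : (Fin m × Fin n) →₀ ℕ) :
    (maximalMinor k m n J).coeff (Finsupp.single (i, q) 1 + Finsupp.single (j, p) 1 + γ) =
      -(maximalMinor k m n J).coeff (Finsupp.single (i, p) 1 + Finsupp.single (j, q) 1 + γ) := by
  have key : ∀ (p q : Fin n) (s : Equiv.Perm (Fin m)),
      graphExponent (J ∘ s) = Finsupp.single (i, p) 1 + Finsupp.single (j, q) 1 + γ →
      graphExponent (J ∘ (s * Equiv.swap i j)) =
        Finsupp.single (i, q) 1 + Finsupp.single (j, p) 1 + γ := by
    intro p q s h
    have h1 : (J ∘ s) i = p := by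
      by_contra hne
      have := DFunLike.congr_fun h (i, p)
      rw [graphExponent_apply, if_neg hne] at this
      simp at this
      omega
    have h2 : (J ∘ s) j = q := by
      by_contra hne
      have := DFunLike.congr_fun h (j, q)
      rw [graphExponent_apply, if_neg hne] at this
      simp at this
      omega
    have h3 := graphExponent_comp_swap (J ∘ s) hij
    rw [h1, h2, h] at h3
    rw [Equiv.Perm.coe_mul, ← Function.comp_assoc]
    refine add_right_cancel (h3.trans ?_)
    abel
  rw [coeff_maximalMinor, coeff_maximalMinor, ← Finset.sum_neg_distrib]
  refine Fintype.sum_equiv (Equiv.mulRight (Equiv.swap i j)) _ _ fun s => ?_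
  rw [Equiv.coe_mulRight]
  by_cases h : graphExponent (J ∘ s) = Finsupp.single (i, q) 1 + Finsupp.single (j, p) 1 + γ
  · rw [if_pos h, if_pos (key _ _ _ h), Equiv.Perm.sign_mul, Equiv.Perm.sign_swap hij]
    simp
  · rw [if_neg h, if_neg, neg_zero]
    intro h'
    have := key _ _ _ h'
    rw [mul_assoc, Equiv.swap_mul_self, mul_one] at this
    exact h this

theorem mem_maximalMinorApolarIdeal_iff (f : MvPolynomial (Fin m × Fin n) k) :
    f ∈ maximalMinorApolarIdeal k m n ↔
      ∀ (J : Fin m ↪o Fin n) γ, contractCoeff (maximalMinor k m n J) γ f = 0 := by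
  rw [maximalMinorApolarIdeal, maximalMinorModule, Submodule.mem_annihilator_span]
  simp only [Subtype.forall, Set.forall_mem_range, smul_ofPoly_eq_zero_iff]

theorem monomial_mem_maximalMinorApolarIdeal {a : (Fin m × Fin n) →₀ ℕ}
    (ha : ¬ IsMatchingExponent a) (c : k) : monomial a c ∈ maximalMinorApolarIdeal k m n := by
  refine (mem_maximalMinorApolarIdeal_iff _).2 fun J γ => ?_
  rw [contractCoeff_monomial, coeff_maximalMinor_eq_zero (fun h => ha h.of_add_left), mul_zero]

theorem contractCoeff_eq_sum {σ : Type*} (F : MvPolynomial σ k) (γ : σ →₀ ℕ) (f : MvPolynomial σ k) :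
    contractCoeff F γ f = ∑ a ∈ f.support, f.coeff a * F.coeff (a + γ) := by
  conv_lhs => rw [f.as_sum, map_sum]
  exact Finset.sum_congr rfl fun a _ => contractCoeff_monomial F γ a _

/-- A functional vanishing on the apolar ideal and isolating the multidegree of a given matching. -/
theorem IsMatchingExponent.exists_functional (hm : 0 < m) (hmn : m ≤ n)
    {a : (Fin m × Fin n) →₀ ℕ} (ha : IsMatchingExponent a) :
    ∃ φ : MvPolynomial (Fin m × Fin n) k →ₗ[k] k,
      (∀ f ∈ maximalMinorApolarIdeal k m n, φ f = 0) ∧ φ (monomial a 1) ≠ 0 ∧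
        ∀ b, φ (monomial b 1) ≠ 0 → multideg b = multideg a := by
  have : Nonempty (Fin n) := ⟨⟨0, hm.trans_le hmn⟩⟩
  obtain ⟨f, hf, hle⟩ := ha.exists_le_graphExponent (by simpa using hmn)
  have hcard : (Finset.univ.image f).card = m := by
    rw [Finset.card_image_of_injective _ hf, Finset.card_univ, Fintype.card_fin]
  let J := (Finset.univ.image f).orderEmbOfFin hcard
  have hex : ∀ i, ∃ j, J j = f i := fun i => by
    have : f i ∈ Set.range J := by
      rw [Finset.range_orderEmbOfFin]
      simp
    exact this
  choose s hs using hex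
  have hinj : Function.Injective s := fun i j h => hf (by rw [← hs, ← hs, h])
  let t : Equiv.Perm (Fin m) := Equiv.ofBijective s (Finite.injective_iff_bijective.1 hinj)
  have hft : f = J ∘ t := funext fun i => (hs i).symm
  -- `γ` is the complement of `a` in the completed matching. A monomial `x^b` is seen only if `b +
  -- γ` is a term of the minor `J`; all such terms have the multidegree of `a + γ`, and `γ` cancels.
  obtain ⟨γ, hγ⟩ := exists_add_of_le hle
  refine ⟨contractCoeff (maximalMinor k m n J) γ,
    fun g hg => (mem_maximalMinorApolarIdeal_iff g).1 hg J γ, ?_, fun b hb => ?_⟩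
  · rw [contractCoeff_monomial, one_mul, ← hγ, hft]
    exact coeff_maximalMinor_graphExponent_ne_zero J t
  · rw [contractCoeff_monomial, one_mul] at hb
    obtain ⟨u, hu⟩ := exists_of_coeff_maximalMinor_ne_zero hb
    have := multideg_graphExponent_comp J u t
    rw [hu, ← hft, hγ, map_add, map_add] at this
    exact add_right_cancel this

/-- Minors are homogeneous of degree `m`, so the functional at `γ` sees only the component of degree
`m - γ.degree`. On the component of degree `d` it either agrees with its value on `f` or vanishes.
-/
theorem homogeneousComponent_mem_maximalMinorApolarIdeal {f : MvPolynomial (Fin m × Fin n) k}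
    (hf : f ∈ maximalMinorApolarIdeal k m n) (d : ℕ) :
    homogeneousComponent d f ∈ maximalMinorApolarIdeal k m n := by
  classical
  rw [mem_maximalMinorApolarIdeal_iff] at hf ⊢
  intro J γ
  have hdeg : ∀ a, (maximalMinor k m n J).coeff (a + γ) ≠ 0 → a.degree + γ.degree = m := by
    intro a ha
    obtain ⟨s, hs⟩ := exists_of_coeff_maximalMinor_ne_zero ha
    rw [← map_add, ← hs, ← degree_rowDeg, rowDeg_graphExponent, map_sum]
    simp
  rw [homogeneousComponent_apply, map_sum]
  simp only [contractCoeff_monomial]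
  by_cases hd : d + γ.degree = m
  · rw [← hf J γ, contractCoeff_eq_sum, Finset.sum_filter]
    refine Finset.sum_congr rfl fun a _ => ?_
    split_ifs with h
    · rfl
    · by_contra h0
      have := hdeg a (right_ne_zero_of_mul (Ne.symm h0))
      omega
  · refine Finset.sum_eq_zero fun a ha => ?_
    by_contra h0
    have := hdeg a (right_ne_zero_of_mul h0)
    rw [Finset.mem_filter] at ha
    omega

end Apolar

/-! ### The generic quadrics -/

section Quadrics

variable (k : Type*) [Field k] {m n : ℕ}

/-- The exponent vector of `x_v x_w`. -/
noncomputable abbrev pairExponent {σ : Type*} (v w : σ) : σ →₀ ℕ :=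
  Finsupp.single v 1 + Finsupp.single w 1

/-- The generic quadric on the rows `i`, `j` and the columns `p`, `q`. -/
noncomputable def quadric (i j : Fin m) (p q : Fin n) : MvPolynomial (Fin m × Fin n) k :=
  if i = j ∨ p = q then monomial (pairExponent (i, p) (j, q)) 1
  else monomial (pairExponent (i, p) (j, q)) 1 + monomial (pairExponent (i, q) (j, p)) 1

theorem X_mul_X_eq_monomial {σ : Type*} (v w : σ) :
    (X v * X w : MvPolynomial σ k) = monomial (pairExponent v w) 1 := by
  rw [X, X, monomial_mul, one_mul]

/-- The four families merge into one. When `i = j` or `p = q` the two monomials of the binomial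
coincide, and `quadric` keeps one copy, since their sum would vanish in characteristic two. -/
theorem mem_genericQuadrics_iff (f : MvPolynomial (Fin m × Fin n) k) :
    f ∈ genericQuadrics k m n ↔ ∃ i j p q, quadric k i j p q = f := by
  simp only [genericQuadrics, Set.mem_union, Set.mem_ofPred_eq, sq, X_mul_X_eq_monomial]
  constructor
  · rintro (((⟨i, p, rfl⟩ | ⟨i, j, p, -, rfl⟩) | ⟨i, p, q, -, rfl⟩) | ⟨i, j, p, q, hij, hpq, rfl⟩)
    · exact ⟨i, i, p, p, if_pos (Or.inl rfl)⟩
    · exact ⟨i, j, p, p, if_pos (Or.inr rfl)⟩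
    · exact ⟨i, i, p, q, if_pos (Or.inl rfl)⟩
    · exact ⟨i, j, p, q, if_neg (by tauto)⟩
  · rintro ⟨i, j, p, q, rfl⟩
    rw [quadric]
    split_ifs with h
    · left
      by_cases hij : i = j
      · subst hij
        by_cases hpq : p = q
        · subst hpq
          exact Or.inl (Or.inl ⟨i, p, rfl⟩)
        · exact Or.inr ⟨i, p, q, hpq, rfl⟩
      · obtain rfl := h.resolve_left hij
        exact Or.inl (Or.inr ⟨i, j, p, hij, rfl⟩)
    · push Not at h
      exact Or.inr ⟨i, j, p, q, h.1, h.2, rfl⟩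

theorem pairExponent_comm {σ : Type*} (v w : σ) : pairExponent v w = pairExponent w v := add_comm _ _

theorem pairExponent_ne {i j : Fin m} {p q : Fin n} (h : ¬(i = j ∨ p = q)) :
    pairExponent (i, p) (j, q) ≠ pairExponent (i, q) (j, p) := by
  push Not at h
  intro h0
  have := DFunLike.congr_fun h0 (i, p)
  simp [h.1, h.2] at this

theorem quadric_swap_rows (i j : Fin m) (p q : Fin n) : quadric k i j p q = quadric k j i p q := by
  rw [quadric, quadric]
  by_cases h : i = j
  · subst h; rfl
  · by_cases h' : p = q
    · subst h'
      rw [if_pos (Or.inr rfl), if_pos (Or.inr rfl), pairExponent_comm]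
    · rw [if_neg (by tauto), if_neg (by tauto), add_comm, pairExponent_comm (i, q),
        pairExponent_comm (i, p)]

theorem quadric_swap_cols (i j : Fin m) (p q : Fin n) : quadric k i j p q = quadric k i j q p := by
  rw [quadric, quadric]
  by_cases h : p = q
  · subst h; rfl
  · by_cases h' : i = j
    · subst h'
      rw [if_pos (Or.inl rfl), if_pos (Or.inl rfl), pairExponent_comm]
    · rw [if_neg (by tauto), if_neg (by tauto), add_comm]

theorem coeff_quadric_self (i j : Fin m) (p q : Fin n) :
    (quadric k i j p q).coeff (pairExponent (i, p) (j, q)) = 1 := by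
  classical
  rw [quadric]
  split_ifs with h
  · rw [coeff_monomial, if_pos rfl]
  · rw [coeff_add, coeff_monomial, coeff_monomial, if_pos rfl, if_neg (pairExponent_ne h).symm,
      add_zero]

theorem quadric_ne_zero (i j : Fin m) (p q : Fin n) : quadric k i j p q ≠ 0 := by
  intro h
  have := coeff_quadric_self k i j p q
  rw [h, coeff_zero] at this
  exact zero_ne_one this

variable {k} in
theorem mem_support_quadric {i j : Fin m} {p q : Fin n} {a : (Fin m × Fin n) →₀ ℕ}
    (ha : a ∈ (quadric k i j p q).support) :
    a = pairExponent (i, p) (j, q) ∨ ¬(i = j ∨ p = q) ∧ a = pairExponent (i, q) (j, p) := by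
  classical
  rw [mem_support_iff, quadric] at ha
  split_ifs at ha with h
  · rw [coeff_monomial] at ha
    exact Or.inl (by_contra fun h' => ha (if_neg fun h'' => h' h''.symm))
  · rw [coeff_add, coeff_monomial, coeff_monomial] at ha
    by_contra! h'
    rw [if_neg h'.1.symm, if_neg (h'.2 (not_or.1 h)).symm, add_zero] at ha
    exact ha rfl

variable {k} in
theorem multideg_of_mem_support_quadric {i j : Fin m} {p q : Fin n} {a : (Fin m × Fin n) →₀ ℕ}
    (ha : a ∈ (quadric k i j p q).support) :
    rowDeg a = pairExponent i j ∧ colDeg a = pairExponent p q := by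
  rcases mem_support_quadric ha with rfl | ⟨-, rfl⟩
  · simp
  · simp [add_comm]

theorem isHomogeneous_quadric (i j : Fin m) (p q : Fin n) :
    (quadric k i j p q).IsHomogeneous 2 := by
  rw [quadric]
  split_ifs
  · exact isHomogeneous_monomial _ (by simp)
  · exact (isHomogeneous_monomial _ (by simp)).add (isHomogeneous_monomial _ (by simp))

/-- Two monomials occur only if `i ≠ j` and `p ≠ q`, and then the four variables involved are
distinct. -/
theorem isTidy_quadric (i j : Fin m) (p q : Fin n) : IsTidy (quadric k i j p q) := by
  refine ⟨⟨2, isHomogeneous_quadric k i j p q⟩, fun v a ha b hb hav hbv => ?_⟩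
  have hmem : ∀ {w x : Fin m × Fin n}, pairExponent w x v ≠ 0 → v = w ∨ v = x := by
    intro w x h
    by_contra! h'
    simp [h'.1.symm, h'.2.symm] at h
  rcases mem_support_quadric ha with rfl | ⟨h, rfl⟩ <;>
  rcases mem_support_quadric hb with rfl | ⟨h', rfl⟩
  · rfl
  · rcases hmem hav with rfl | rfl <;> rcases hmem hbv with h | h <;>
      simp only [Prod.mk.injEq] at h <;> tauto
  · rcases hmem hav with rfl | rfl <;> rcases hmem hbv with h | h <;>
      simp only [Prod.mk.injEq] at h <;> tauto
  · rfl

theorem sym2_eq_of_pairExponent_eq {σ : Type*} {v w v' w' : σ}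
    (h : pairExponent v w = pairExponent v' w') : s(v, w) = s(v', w') := by
  rw [pairExponent, pairExponent, Finsupp.single_add_single_eq_single_add_single one_ne_zero
    one_ne_zero] at h
  rw [Sym2.eq_iff]
  tauto

/-- By symmetry a quadric depends only on an unordered pair of rows and an unordered pair of
columns, repetitions allowed. The multidegree of any of its terms recovers both pairs. -/
theorem ncard_genericQuadrics (m n : ℕ) :
    (genericQuadrics k m n).ncard = (m + 1).choose 2 * (n + 1).choose 2 := by
  let φ : Sym2 (Fin m) → Sym2 (Fin n) → MvPolynomial (Fin m × Fin n) k :=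
    Sym2.lift₂ ⟨quadric k, fun i j p q => ⟨quadric_swap_rows k i j p q, quadric_swap_cols k i j p q⟩⟩
  have hφ : ∀ i j p q, φ s(i, j) s(p, q) = quadric k i j p q := fun i j p q => rfl
  have hrange : genericQuadrics k m n = Set.range (Function.uncurry φ) := by
    ext f
    rw [mem_genericQuadrics_iff]
    constructor
    · rintro ⟨i, j, p, q, rfl⟩
      exact ⟨(s(i, j), s(p, q)), rfl⟩
    · rintro ⟨⟨⟨i, j⟩, ⟨p, q⟩⟩, rfl⟩
      exact ⟨i, j, p, q, rfl⟩
  have hinj : Function.Injective (Function.uncurry φ) := by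
    rintro ⟨⟨i, j⟩, ⟨p, q⟩⟩ ⟨⟨i', j'⟩, ⟨p', q'⟩⟩ h
    have h : quadric k i j p q = quadric k i' j' p' q' := h
    have hs : pairExponent (i, p) (j, q) ∈ (quadric k i' j' p' q').support := by
      rw [← h, mem_support_iff, coeff_quadric_self]
      exact one_ne_zero
    obtain ⟨h1, h2⟩ := multideg_of_mem_support_quadric hs
    simp only [map_add, rowDeg_single, colDeg_single] at h1 h2
    exact Prod.ext (sym2_eq_of_pairExponent_eq h1) (sym2_eq_of_pairExponent_eq h2)
  rw [hrange, ← Set.image_univ, Set.ncard_image_of_injective _ hinj, Set.ncard_univ,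
    Nat.card_prod, Nat.card_eq_fintype_card, Nat.card_eq_fintype_card, Sym2.card, Sym2.card,
    Fintype.card_fin, Fintype.card_fin]

theorem finite_genericQuadrics (m n : ℕ) : (genericQuadrics k m n).Finite := by
  have h : genericQuadrics k m n =
      Set.range fun x : (Fin m × Fin m) × (Fin n × Fin n) => quadric k x.1.1 x.1.2 x.2.1 x.2.2 := by
    ext f
    simp [mem_genericQuadrics_iff]
  rw [h]
  exact Set.finite_range _

theorem not_isMatchingExponent_pairExponent {i j : Fin m} {p q : Fin n} (h : i = j ∨ p = q) :
    ¬ IsMatchingExponent (pairExponent (i, p) (j, q)) := by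
  rintro ⟨h1, h2⟩
  rcases h with rfl | rfl
  · simpa using h1 i
  · simpa using h2 p

theorem quadric_mem_maximalMinorApolarIdeal (i j : Fin m) (p q : Fin n) :
    quadric k i j p q ∈ maximalMinorApolarIdeal k m n := by
  rw [quadric]
  split_ifs with h
  · exact monomial_mem_maximalMinorApolarIdeal (not_isMatchingExponent_pairExponent h) 1
  · refine (mem_maximalMinorApolarIdeal_iff _).2 fun J γ => ?_
    rw [map_add, contractCoeff_monomial, contractCoeff_monomial, one_mul, one_mul,
      coeff_maximalMinor_swap J (fun hij => h (Or.inl hij))]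
    exact neg_add_cancel _

end Quadrics

/-! ### Leading terms -/

section RevLexGroebner

open scoped MonomialOrder

variable {k : Type*} [Field k] {m n : ℕ}

theorem degree_quadric_of_eq (ord : MonomialOrder (Fin m × Fin n)) {i j : Fin m} {p q : Fin n}
    (h : i = j ∨ p = q) : ord.degree (quadric k i j p q) = pairExponent (i, p) (j, q) := by
  classical
  rw [quadric, if_pos h, MonomialOrder.degree_monomial, if_neg one_ne_zero]

theorem degree_quadric_of_lt (ord : MonomialOrder (Fin m × Fin n)) {i j : Fin m} {p q : Fin n}
    (h : ¬(i = j ∨ p = q)) (hlt : pairExponent (i, q) (j, p) ≺[ord] pairExponent (i, p) (j, q)) :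
    ord.degree (quadric k i j p q) = pairExponent (i, p) (j, q) := by
  classical
  have h1 : ∀ a, ord.degree (monomial a (1 : k)) = a := fun a => by
    rw [MonomialOrder.degree_monomial, if_neg one_ne_zero]
  rw [quadric, if_neg h, MonomialOrder.degree_add_of_lt, h1]
  rwa [h1, h1]

theorem isMatchingExponent_of_not_degree_le {ord : MonomialOrder (Fin m × Fin n)}
    {a : (Fin m × Fin n) →₀ ℕ} (ha : ∀ g ∈ genericQuadrics k m n, ¬ ord.degree g ≤ a) :
    IsMatchingExponent a := by
  by_contra h
  obtain ⟨⟨i, p⟩, ⟨j, q⟩, hvw, b, rfl⟩ := exists_of_not_isMatchingExponent h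
  refine ha _ ((mem_genericQuadrics_iff k _).2 ⟨i, j, p, q, rfl⟩) ?_
  rw [degree_quadric_of_eq ord hvw]
  exact le_self_add

/-- Among the monomials of a given multidegree, the standard one is the smallest. -/
theorem not_lt_of_not_degree_le {ord : LinearOrder (Fin m × Fin n)}
    {a b : (Fin m × Fin n) →₀ ℕ}
    (ha : ∀ g ∈ genericQuadrics k m n, ¬ (degRevLex ord).degree g ≤ a)
    (hab : multideg b = multideg a) : ¬ b ≺[degRevLex ord] a := by
  have hma : IsMatchingExponent a := isMatchingExponent_of_not_degree_le ha
  have hmb : IsMatchingExponent b := hma.of_multideg_eq hab.symm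
  obtain ⟨hrow, hcol⟩ := (multideg_eq_iff _ _).1 hab
  intro hlt
  rcases (degRevLex_lt_iff ord b a).1 hlt with h | ⟨-, ⟨i, j⟩, hbelow, hv⟩
  · exact h.ne (degree_eq_of_multideg_eq hab)
  have hbv : b (i, j) ≠ 0 := by omega
  have hav : a (i, j) = 0 := by
    have := hmb.apply_le_one (i, j)
    omega
  -- Here `(i, j)` is the lowest variable at which `a` and `b` differ, and it divides only `x^b`.
  -- Since the multidegrees agree, `a` meets row `i` and column `j` elsewhere.
  obtain ⟨l, hl⟩ := exists_of_rowDeg_ne_zero (hrow ▸ rowDeg_ne_zero hbv : rowDeg a i ≠ 0)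
  obtain ⟨h, hh⟩ := exists_of_colDeg_ne_zero (hcol ▸ colDeg_ne_zero hbv : colDeg a j ≠ 0)
  have hlj : l ≠ j := by rintro rfl; exact hl hav
  have hhi : h ≠ i := by rintro rfl; exact hh hav
  obtain ⟨c, hc⟩ := exists_eq_single_add_single_add (by simp [hlj]) hl hh
  have hne : ¬(i = h ∨ l = j) := by tauto
  -- the smallest of the four variables divides the nonleading monomial of the binomial
  have hnlt : ¬ pairExponent (i, j) (h, l) ≺[degRevLex ord] pairExponent (i, l) (h, j) := by
    intro hlt'
    refine ha _ ((mem_genericQuadrics_iff k _).2 ⟨i, h, l, j, rfl⟩) ?_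
    rw [degree_quadric_of_lt _ hne hlt', hc]
    exact le_self_add
  have hlt' : pairExponent (i, l) (h, j) ≺[degRevLex ord] pairExponent (i, j) (h, l) :=
    lt_of_le_of_ne (not_lt.1 hnlt) fun h0 =>
      pairExponent_ne hne ((degRevLex ord).toSyn.injective h0)
  rcases (degRevLex_lt_iff ord _ _).1 hlt' with h0 | ⟨-, w, hw, hw'⟩
  · simp at h0
  have hwmem : w = (i, l) ∨ w = (h, j) := by
    by_contra! h0
    simp [h0.1.symm, h0.2.symm] at hw'
  -- The two monomials of the binomial differ at `(i, j)`, so the lowest variable `w` at which they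
  -- differ cannot lie above it.
  have hwv : ord.lt w (i, j) := by
    rcases @lt_trichotomy _ ord w (i, j) with h0 | h0 | h0
    · exact h0
    · rcases hwmem with rfl | rfl <;> simp only [Prod.mk.injEq] at h0 <;> tauto
    · have := hw _ h0
      simp [Ne.symm hlj, Ne.symm hhi] at this
  -- Below `(i, j)` the exponents agree, so `b` also contains `w`, which shares a row or a column
  -- with `(i, j)`; a matching cannot contain both.
  have hbw := hbelow w hwv
  rcases hwmem with rfl | rfl
  · exact hlj (hmb.snd_eq (hbw ▸ hl) hbv)
  · exact hhi (hmb.fst_eq (hbw ▸ hh) hbv)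

/-- Otherwise the leading exponent `a` is smallest in its multidegree, so no other term of `f`
shares that multidegree. The functional attached to `a` is then nonzero on `f`, although it kills
the ideal. -/
theorem exists_degree_quadric_le (hm : 0 < m) (hmn : m ≤ n) (ord : LinearOrder (Fin m × Fin n))
    {f : MvPolynomial (Fin m × Fin n) k} (hf : f ∈ maximalMinorApolarIdeal k m n) (hf0 : f ≠ 0) :
    ∃ g ∈ genericQuadrics k m n, (degRevLex ord).degree g ≤ (degRevLex ord).degree f := by
  by_contra! ha
  have hma := isMatchingExponent_of_not_degree_le ha
  obtain ⟨φ, hφI, hφ, hφb⟩ := hma.exists_functional (k := k) hm hmn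
  set a := (degRevLex ord).degree f with ha_def
  have h0 := hφI f hf
  have hmon : ∀ b, φ (monomial b (f.coeff b)) = f.coeff b * φ (monomial b 1) := fun b => by
    rw [← smul_eq_mul, ← map_smul, smul_monomial, smul_eq_mul, mul_one]
  rw [f.as_sum, map_sum, Finset.sum_eq_single a, hmon] at h0
  · exact mul_ne_zero ((degRevLex ord).leadingCoeff_ne_zero_iff.2 hf0) hφ h0
  · intro b hb hba
    rw [hmon]
    by_contra hne
    refine not_lt_of_not_degree_le ha (hφb b (right_ne_zero_of_mul hne)) (lt_of_le_of_ne
      ((degRevLex ord).le_degree hb) fun h => hba ((degRevLex ord).toSyn.injective h))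
  · intro h
    rw [notMem_support_iff.1 h, monomial_zero, map_zero]

theorem isRevLexUniversalGroebnerBasis_genericQuadrics (hm : 0 < m) (hmn : m ≤ n) :
    IsRevLexUniversalGroebnerBasis (genericQuadrics k m n) (maximalMinorApolarIdeal k m n) := by
  have hsub : genericQuadrics k m n ⊆ maximalMinorApolarIdeal k m n := by
    intro f hf
    obtain ⟨i, j, p, q, rfl⟩ := (mem_genericQuadrics_iff k f).1 hf
    exact quadric_mem_maximalMinorApolarIdeal k i j p q
  refine fun ord => ⟨finite_genericQuadrics k m n, hsub, le_antisymm (Ideal.span_le.2 ?_)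
    (Ideal.span_mono (Set.image_mono hsub))⟩
  rintro _ ⟨f, hf, rfl⟩
  rcases eq_or_ne f 0 with rfl | hf0
  · rw [MonomialOrder.leadingTerm_zero]
    exact zero_mem _
  obtain ⟨g, hg, hle⟩ := exists_degree_quadric_le hm hmn ord hf hf0
  have hg0 : g ≠ 0 := by
    obtain ⟨i, j, p, q, rfl⟩ := (mem_genericQuadrics_iff k g).1 hg
    exact quadric_ne_zero k i j p q
  obtain ⟨c, hc⟩ := exists_add_of_le hle
  have : (degRevLex ord).leadingTerm f =
      monomial c ((degRevLex ord).leadingCoeff f / (degRevLex ord).leadingCoeff g) *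
        (degRevLex ord).leadingTerm g := by
    rw [MonomialOrder.leadingTerm, MonomialOrder.leadingTerm, monomial_mul, hc, add_comm c,
      div_mul_cancel₀ _ ((degRevLex ord).leadingCoeff_ne_zero_iff.2 hg0)]
  rw [SetLike.mem_coe, this]
  exact Ideal.mul_mem_left _ _ (Ideal.subset_span ⟨g, hg, rfl⟩)

end RevLexGroebner

/-! ### The grading of the quotient -/

section Grading

variable {σ k : Type*} [Field k]

theorem mem_quotientGrading_iff {I : Ideal (MvPolynomial σ k)} {d : ℕ} {x : MvPolynomial σ k ⧸ I} :
    x ∈ quotientGrading I d ↔ ∃ f : MvPolynomial σ k, f.IsHomogeneous d ∧ Ideal.Quotient.mk I f = x :=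
  Iff.rfl

theorem quotientGrading_one (I : Ideal (MvPolynomial σ k)) :
    quotientGrading I 1 = Submodule.span k (Set.range fun v => Ideal.Quotient.mk I (X v)) := by
  rw [quotientGrading, homogeneousSubmodule_one_eq_span_X, Submodule.map_span, ← Set.range_comp]
  rfl

/-- A relation between classes of different degrees lifts to a sum of homogeneous polynomials lying
in `I`; taking components puts each summand in `I`. -/
theorem isInternal_quotientGrading {I : Ideal (MvPolynomial σ k)}
    (hI : ∀ f ∈ I, ∀ d, homogeneousComponent d f ∈ I) :
    DirectSum.IsInternal (quotientGrading I) := by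
  rw [DirectSum.isInternal_submodule_iff_iSupIndep_and_iSup_eq_top]
  constructor
  · rw [iSupIndep_iff_finsetSum_eq_zero_imp_eq_zero]
    intro s v hv hsum d hd
    have hex : ∀ i, ∃ f : MvPolynomial σ k, i ∈ s →
        f.IsHomogeneous i ∧ Ideal.Quotient.mk I f = v i := fun i => by
      by_cases hi : i ∈ s
      · obtain ⟨f, hf⟩ := mem_quotientGrading_iff.1 (hv i hi)
        exact ⟨f, fun _ => hf⟩
      · exact ⟨0, fun h => absurd h hi⟩
    choose f hf using hex
    have hmem : ∑ i ∈ s, f i ∈ I := by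
      rw [← Ideal.Quotient.eq_zero_iff_mem, map_sum, ← hsum]
      exact Finset.sum_congr rfl fun i hi => (hf i hi).2
    have := hI _ hmem d
    rw [map_sum, Finset.sum_eq_single d, homogeneousComponent_of_mem (hf d hd).1, if_pos rfl] at this
    · rw [← (hf d hd).2]
      exact Ideal.Quotient.eq_zero_iff_mem.2 this
    · intro i hi hid
      rw [homogeneousComponent_of_mem (hf i hi).1, if_neg hid.symm]
    · exact fun h => absurd hd h
  · rw [eq_top_iff]
    rintro x -
    obtain ⟨f, rfl⟩ := Ideal.Quotient.mk_surjective x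
    rw [← sum_homogeneousComponent f, map_sum]
    exact Submodule.sum_mem _ fun i _ => Submodule.mem_iSup_of_mem i
      (mem_quotientGrading_iff.2 ⟨_, homogeneousComponent_isHomogeneous i f, rfl⟩)

theorem isStandardGraded_quotientGrading [Finite σ] {I : Ideal (MvPolynomial σ k)} (hI1 : I ≠ ⊤)
    (hI : ∀ f ∈ I, ∀ d, homogeneousComponent d f ∈ I) :
    IsStandardGraded k (quotientGrading I) where
  gradedMonoid :=
    { one_mem := ⟨1, isHomogeneous_one σ k, map_one (Ideal.Quotient.mk I)⟩
      mul_mem := by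
        rintro i j _ _ ⟨f, hf, rfl⟩ ⟨g, hg, rfl⟩
        exact ⟨f * g, IsHomogeneous.mul hf hg, map_mul (Ideal.Quotient.mk I) _ _⟩ }
  isInternal := isInternal_quotientGrading hI
  injective := by
    have : Nontrivial (MvPolynomial σ k ⧸ I) := Ideal.Quotient.nontrivial_iff.2 hI1
    exact (algebraMap k (MvPolynomial σ k ⧸ I)).injective
  degree_zero := by
    rw [quotientGrading, homogeneousSubmodule_zero]
    exact Submodule.map_one _
  finite := by
    rw [quotientGrading_one]
    exact Module.Finite.span_of_finite k (Set.finite_range _)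
  generated := by
    rw [eq_top_iff, quotientGrading_one]
    refine le_trans ?_ (Algebra.adjoin_mono Submodule.subset_span)
    have h : (Set.range fun v => Ideal.Quotient.mk I (X v)) =
        Ideal.Quotient.mkₐ k I '' Set.range X := by
      rw [← Set.range_comp]
      rfl
    rw [h, ← AlgHom.map_adjoin, adjoin_range_X, Algebra.map_top,
      (AlgHom.range_eq_top _).2 (Ideal.Quotient.mkₐ_surjective k I)]

end Grading

/-! ### Colon ideals -/

section Colon

variable {k : Type*} [Field k] {m n : ℕ}

/-! ### Reduction of monomials within a multidegree. -/

theorem monomial_mem_of_sub_mem {σ : Type*} {K : Ideal (MvPolynomial σ k)} {a b : σ →₀ ℕ} {c : k}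
    (h : monomial a 1 - monomial b c ∈ K) (hb : monomial b 1 ∈ K) : monomial a 1 ∈ K := by
  have : (monomial a 1 : MvPolynomial σ k) = (monomial a 1 - monomial b c) + C c * monomial b 1 := by
    rw [C_mul_monomial, mul_one, sub_add_cancel]
  rw [this]
  exact add_mem h (K.mul_mem_left _ hb)

/-- The exchange step: if `a` meets row `i` at column `l` and column `j` at row `h`, a quadric
replaces `x_{il} x_{hj}` by `-x_{ij} x_{hl}`. Any cell in an occupied row and an occupied column can
thus be made a factor. -/
theorem exists_sub_monomial_single_add_mem {a : (Fin m × Fin n) →₀ ℕ} {i : Fin m} {j : Fin n}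
    (hi : rowDeg a i ≠ 0) (hj : colDeg a j ≠ 0) :
    ∃ (b : (Fin m × Fin n) →₀ ℕ) (c : k), multideg a = multideg (Finsupp.single (i, j) 1 + b) ∧
      monomial a 1 - monomial (Finsupp.single (i, j) 1 + b) c ∈ maximalMinorApolarIdeal k m n := by
  by_cases haij : a (i, j) = 0
  · obtain ⟨l, hl⟩ := exists_of_rowDeg_ne_zero hi
    obtain ⟨h, hh⟩ := exists_of_colDeg_ne_zero hj
    have hlj : l ≠ j := by rintro rfl; exact hl haij
    have hhi : h ≠ i := by rintro rfl; exact hh haij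
    obtain ⟨c, rfl⟩ := exists_eq_single_add_single_add (by simp [hlj]) hl hh
    refine ⟨Finsupp.single (h, l) 1 + c, -1, ?_, ?_⟩
    · rw [multideg_eq_iff]
      simp only [map_add, rowDeg_single, colDeg_single, add_assoc, true_and]
      abel
    · have := Ideal.mul_mem_left _ (monomial c 1)
        (quadric_mem_maximalMinorApolarIdeal k i h l j)
      rw [quadric, if_neg (by tauto), mul_add, monomial_mul, monomial_mul, one_mul] at this
      convert this using 1
      rw [map_neg, sub_neg_eq_add, ← add_assoc, add_comm c, add_comm c]
  · obtain ⟨b, rfl⟩ := exists_eq_single_add haij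
    exact ⟨b, 1, rfl, by rw [sub_self]; exact zero_mem _⟩

/-- Exchange brings a variable of `b` into `a`; cancelling it lowers the degree. -/
theorem exists_sub_monomial_mem_of_multideg_eq (a b : (Fin m × Fin n) →₀ ℕ)
    (hab : multideg a = multideg b) :
    ∃ c : k, monomial a 1 - monomial b c ∈ maximalMinorApolarIdeal k m n := by
  induction hd : b.degree generalizing a b with
  | zero =>
    obtain rfl := (Finsupp.degree_eq_zero_iff b).1 hd
    obtain rfl := (Finsupp.degree_eq_zero_iff a).1 ((degree_eq_of_multideg_eq hab).trans hd)
    exact ⟨1, by rw [sub_self]; exact zero_mem _⟩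
  | succ d ih =>
    have hb0 : b ≠ 0 := by rintro rfl; simp at hd
    obtain ⟨⟨i, j⟩, hv⟩ := Finsupp.ne_iff.1 hb0
    obtain ⟨hrow, hcol⟩ := (multideg_eq_iff _ _).1 hab
    obtain ⟨a', c, ha', hc⟩ := exists_sub_monomial_single_add_mem (k := k)
      (hrow ▸ rowDeg_ne_zero hv : rowDeg a i ≠ 0) (hcol ▸ colDeg_ne_zero hv : colDeg a j ≠ 0)
    obtain ⟨b', rfl⟩ := exists_eq_single_add hv
    rw [ha', map_add, map_add] at hab
    rw [map_add, Finsupp.degree_single] at hd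
    obtain ⟨e, he⟩ := ih a' b' (add_left_cancel hab) (by omega)
    refine ⟨c * e, ?_⟩
    have := add_mem hc (Ideal.mul_mem_left _ (monomial (Finsupp.single (i, j) 1) c) he)
    rwa [mul_sub, monomial_mul, monomial_mul, mul_one, sub_add_sub_cancel] at this

/-- Normal forms modulo an ideal containing the apolar ideal. -/
theorem exists_sub_mem_of_maximalMinorApolarIdeal_le {K : Ideal (MvPolynomial (Fin m × Fin n) k)}
    (hK : maximalMinorApolarIdeal k m n ≤ K) (f : MvPolynomial (Fin m × Fin n) k) :
    ∃ g, f - g ∈ K ∧ (∀ a ∈ g.support, monomial a 1 ∉ K) ∧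
      Set.InjOn multideg (g.support : Set ((Fin m × Fin n) →₀ ℕ)) := by
  classical
  -- `r` chooses one representative exponent in each multidegree; normal forms use only
  -- representatives outside `K`.
  let r : ((Fin m × Fin n) →₀ ℕ) → ((Fin m × Fin n) →₀ ℕ) :=
    fun a => Function.invFun multideg (multideg a)
  have hr : ∀ a, multideg (r a) = multideg a := fun a => Function.invFun_eq ⟨a, rfl⟩
  suffices h : ∃ g, f - g ∈ K ∧ ∀ a ∈ g.support, monomial a 1 ∉ K ∧ r a = a by
    obtain ⟨g, hg, hsupp⟩ := h
    refine ⟨g, hg, fun a ha => (hsupp a ha).1, fun a ha b hb hab => ?_⟩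
    rw [← (hsupp a ha).2, ← (hsupp b hb).2]
    exact congrArg (Function.invFun multideg) hab
  induction f using MvPolynomial.induction_on' with
  | monomial a c =>
    obtain ⟨e, he⟩ := exists_sub_monomial_mem_of_multideg_eq (k := k) a (r a) (hr a).symm
    by_cases ha : monomial (r a) (1 : k) ∈ K
    · refine ⟨0, ?_, by simp⟩
      have := K.mul_mem_left (C c) (monomial_mem_of_sub_mem (hK he) ha)
      rwa [C_mul_monomial, mul_one, ← sub_zero (monomial a c)] at this
    · refine ⟨monomial (r a) (c * e), ?_, fun b hb => ?_⟩
      · have := K.mul_mem_left (C c) (hK he)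
        rwa [mul_sub, C_mul_monomial, C_mul_monomial, mul_one] at this
      · obtain rfl := Finset.mem_singleton.1 (support_monomial_subset hb)
        refine ⟨ha, ?_⟩
        simp only [r] at hr ⊢
        rw [hr]
  | add p q hp hq =>
    obtain ⟨g, hg, hg'⟩ := hp
    obtain ⟨h, hh, hh'⟩ := hq
    refine ⟨g + h, by rw [add_sub_add_comm]; exact add_mem hg hh, fun a ha => ?_⟩
    rcases Finset.mem_union.1 (support_add ha) with h1 | h1
    · exact hg' a h1
    · exact hh' a h1

theorem X_mul_X_mem {K : Ideal (MvPolynomial (Fin m × Fin n) k)}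
    (hK : maximalMinorApolarIdeal k m n ≤ K) {i j : Fin m} {p q : Fin n}
    (h : X (i, q) ∈ K ∨ X (j, p) ∈ K) : X (i, p) * X (j, q) ∈ K := by
  have hquad := hK (quadric_mem_maximalMinorApolarIdeal k i j p q)
  rw [quadric] at hquad
  rw [X_mul_X_eq_monomial]
  split_ifs at hquad with h0
  · exact hquad
  · rw [← X_mul_X_eq_monomial k (i, q)] at hquad
    refine (add_mem_cancel_right ?_).1 hquad
    rcases h with h | h
    · exact K.mul_mem_right _ h
    · exact K.mul_mem_left _ h

theorem X_mul_X_mem_of_eq {i j : Fin m} {p q : Fin n} (h : i = j ∨ p = q) :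
    X (i, p) * X (j, q) ∈ maximalMinorApolarIdeal k m n := by
  rw [X_mul_X_eq_monomial]
  exact monomial_mem_maximalMinorApolarIdeal (not_isMatchingExponent_pairExponent h) 1

/-- This is the colon condition lifted to the polynomial ring. The point is that a nonzero normal
form `g` modulo `L` cannot satisfy `g * X (s, t) ∈ K`. -/
theorem mul_X_mem_span_X_sup_iff (hm : 0 < m) (hmn : m ≤ n) {A : Set (Fin m × Fin n)}
    {s : Fin m} {t : Fin n} (hst : (s, t) ∉ A) (f : MvPolynomial (Fin m × Fin n) k) :
    f * X (s, t) ∈ Ideal.span (X '' A) ⊔ maximalMinorApolarIdeal k m n ↔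
      f ∈ Ideal.span (X '' {v | X v * X (s, t) ∈
        Ideal.span (X '' A) ⊔ maximalMinorApolarIdeal k m n}) ⊔ maximalMinorApolarIdeal k m n := by
  set I := maximalMinorApolarIdeal k m n with hI
  set K := Ideal.span (X '' A) ⊔ I with hKdef
  set D : Set (Fin m × Fin n) := {v | X v * X (s, t) ∈ K} with hD
  set L := Ideal.span (X '' D) ⊔ I with hL
  have hIK : I ≤ K := le_sup_right
  have hIL : I ≤ L := le_sup_right
  have hAK : ∀ v ∈ A, (X v : MvPolynomial (Fin m × Fin n) k) ∈ K := fun v hv =>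
    Ideal.mem_sup_left (Ideal.subset_span ⟨v, hv, rfl⟩)
  have hDL : ∀ v ∈ D, (X v : MvPolynomial (Fin m × Fin n) k) ∈ L := fun v hv =>
    Ideal.mem_sup_left (Ideal.subset_span ⟨v, hv, rfl⟩)
  have hLK : ∀ g ∈ L, g * X (s, t) ∈ K := by
    intro g hg
    have : L ≤ K.colon {X (s, t)} := by
      refine sup_le (Ideal.span_le.2 ?_) fun g hg => ?_
      · rintro _ ⟨v, hv, rfl⟩
        exact Submodule.mem_colon_singleton.2 hv
      · exact Submodule.mem_colon_singleton.2 (K.mul_mem_right _ (hIK hg))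
    exact Submodule.mem_colon_singleton.1 (this hg)
  refine ⟨fun hf => ?_, hLK f⟩
  obtain ⟨g, hfg, hgL, hginj⟩ := exists_sub_mem_of_maximalMinorApolarIdeal_le hIL f
  have hgK : g * X (s, t) ∈ K := by
    have := K.sub_mem hf (hLK _ hfg)
    rwa [sub_mul, sub_sub_cancel] at this
  suffices hg0 : g = 0 by rwa [hg0, sub_zero] at hfg
  by_contra hg0
  obtain ⟨a, ha⟩ := support_nonempty.2 hg0
  have haL := hgL a ha
  have hma : IsMatchingExponent a := by
    by_contra h
    exact haL (hIL (monomial_mem_maximalMinorApolarIdeal h 1))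
  -- By exchange, a cell of `D` in the box of rows and columns met by `a` would divide a monomial
  -- proportional to `x^a` modulo `I`, forcing `x^a ∈ L`.
  have hbox : ∀ i j, (i, j) ∈ D → rowDeg a i ≠ 0 → colDeg a j ≠ 0 → False := by
    intro i j hij hi hj
    obtain ⟨b, c, -, hbc⟩ := exists_sub_monomial_single_add_mem (k := k) hi hj
    refine haL (monomial_mem_of_sub_mem (hIL hbc) ?_)
    have := L.mul_mem_right (monomial b 1) (hDL _ hij)
    rwa [X, monomial_mul, one_mul] at this
  -- All of row `s` and column `t` belongs to `D`, so `a` avoids both and can be extended by `(s,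
  -- t)`.
  have hrow : rowDeg a s = 0 := by
    by_contra h
    obtain ⟨q, hq⟩ := exists_of_rowDeg_ne_zero h
    exact hbox s q (hIK (X_mul_X_mem_of_eq (Or.inl rfl))) h (colDeg_ne_zero hq)
  have hcol : colDeg a t = 0 := by
    by_contra h
    obtain ⟨p, hp⟩ := exists_of_colDeg_ne_zero h
    exact hbox p t (hIK (X_mul_X_mem_of_eq (Or.inr rfl))) (rowDeg_ne_zero hp) h
  have hmat : IsMatchingExponent (a + Finsupp.single (s, t) 1) := by
    refine ⟨fun i => ?_, fun j => ?_⟩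
    · rw [map_add, rowDeg_single, Finsupp.add_apply]
      by_cases h : s = i
      · subst h; simp [hrow]
      · simpa [h] using hma.1 i
    · rw [map_add, colDeg_single, Finsupp.add_apply]
      by_cases h : t = j
      · subst h; simp [hcol]
      · simpa [h] using hma.2 j
  -- The enlarged box contains no cell of `A`: a cell in the new row or column would, through a
  -- binomial quadric, put a cell of the old box into `D`.
  have hA : ∀ i j, (i, j) ∈ A → rowDeg (a + Finsupp.single (s, t) 1) i ≠ 0 →
      colDeg (a + Finsupp.single (s, t) 1) j ≠ 0 → False := by
    intro i j hij hi hj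
    rw [map_add, rowDeg_single, Finsupp.add_apply] at hi
    rw [map_add, colDeg_single, Finsupp.add_apply] at hj
    by_cases his : s = i
    · by_cases hjt : t = j
      · subst his hjt; exact hst hij
      · rw [Finsupp.single_eq_of_ne' hjt, add_zero] at hj
        obtain ⟨p, hp⟩ := exists_of_colDeg_ne_zero hj
        subst his
        exact hbox p j (X_mul_X_mem hIK (Or.inr (hAK _ hij))) (rowDeg_ne_zero hp) hj
    · rw [Finsupp.single_eq_of_ne' his, add_zero] at hi
      by_cases hjt : t = j
      · obtain ⟨q, hq⟩ := exists_of_rowDeg_ne_zero hi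
        subst hjt
        exact hbox i q (X_mul_X_mem hIK (Or.inl (hAK _ hij))) hi (colDeg_ne_zero hq)
      · rw [Finsupp.single_eq_of_ne' hjt, add_zero] at hj
        exact hbox i j (K.mul_mem_right _ (hAK _ hij)) hi hj
  obtain ⟨φ, hφI, hφ, hφb⟩ := hmat.exists_functional (k := k) hm hmn
  have hmon : ∀ b c, φ (monomial b c) = c * φ (monomial b 1) := fun b c => by
    rw [← smul_eq_mul, ← map_smul, smul_monomial, smul_eq_mul, mul_one]
  -- A monomial divisible by a variable of `A` cannot have the multidegree of `a + e_{st}`, by `hA`,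
  -- so `φ` ignores it.
  have hφK : ∀ h ∈ K, φ h = 0 := by
    intro h hh
    obtain ⟨h₁, hh₁, h₂, hh₂, rfl⟩ := Submodule.mem_sup.1 hh
    rw [map_add, hφI h₂ hh₂, add_zero, h₁.as_sum, map_sum]
    refine Finset.sum_eq_zero fun b hb => ?_
    obtain ⟨⟨i, j⟩, hv, hbv⟩ := mem_ideal_span_X_image.1 hh₁ b hb
    rw [hmon]
    by_contra hne
    obtain ⟨h1, h2⟩ := (multideg_eq_iff _ _).1 (hφb b (right_ne_zero_of_mul hne))
    exact hA i j hv (h1 ▸ rowDeg_ne_zero hbv) (h2 ▸ colDeg_ne_zero hbv)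
  have hzero := hφK _ hgK
  rw [g.as_sum, Finset.sum_mul, map_sum, Finset.sum_eq_single a] at hzero
  · rw [X, monomial_mul, mul_one, hmon] at hzero
    exact mul_ne_zero (mem_support_iff.1 ha) hφ hzero
  -- Distinct monomials of `g` have distinct multidegrees, so only `x^a` contributes.
  · intro b hb hba
    rw [X, monomial_mul, mul_one, hmon]
    by_contra hne
    have := hφb _ (right_ne_zero_of_mul hne)
    rw [map_add, map_add] at this
    exact hba (hginj hb ha (add_right_cancel this))
  · exact fun h => absurd ha h

/-- Each single variable is a matching and different variables have different multidegrees, so its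
functional isolates its coefficient. -/
theorem linearIndependent_mk_X (hm : 0 < m) (hmn : m ≤ n) :
    LinearIndependent k fun v : Fin m × Fin n =>
      Ideal.Quotient.mk (maximalMinorApolarIdeal k m n) (X v) := by
  rw [Fintype.linearIndependent_iff]
  intro g hg v
  have hmem : ∑ w, monomial (Finsupp.single w 1) (g w) ∈ maximalMinorApolarIdeal k m n := by
    rw [← Ideal.Quotient.eq_zero_iff_mem, map_sum, ← hg]
    refine Finset.sum_congr rfl fun w _ => ?_
    have : (monomial (Finsupp.single w 1) (g w) : MvPolynomial (Fin m × Fin n) k) = g w • X w := by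
      rw [X, smul_monomial, smul_eq_mul, mul_one]
    rw [this]
    rfl
  have hv : IsMatchingExponent (Finsupp.single v 1) := by
    constructor <;> intro x <;> simp only [rowDeg_single, colDeg_single, Finsupp.single_apply] <;>
      split_ifs <;> simp
  obtain ⟨φ, hφI, hφ, hφb⟩ := hv.exists_functional (k := k) hm hmn
  have hmon : ∀ b c, φ (monomial b c) = c * φ (monomial b 1) := fun b c => by
    rw [← smul_eq_mul, ← map_smul, smul_monomial, smul_eq_mul, mul_one]
  have h0 := hφI _ hmem
  rw [map_sum, Finset.sum_eq_single v, hmon] at h0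
  · exact (mul_eq_zero.1 h0).resolve_right hφ
  · intro w _ hwv
    rw [hmon]
    by_contra hne
    obtain ⟨h1, h2⟩ := (multideg_eq_iff _ _).1 (hφb _ (right_ne_zero_of_mul hne))
    rw [rowDeg_single, rowDeg_single, Finsupp.single_left_inj one_ne_zero] at h1
    rw [colDeg_single, colDeg_single, Finsupp.single_left_inj one_ne_zero] at h2
    exact hwv (Prod.ext h1 h2)
  · simp

theorem maximalMinorApolarIdeal_ne_top (hm : 0 < m) (hmn : m ≤ n) :
    maximalMinorApolarIdeal k m n ≠ ⊤ := by
  intro h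
  -- The functional of the empty matching is nonzero on `1`.
  have h0 : IsMatchingExponent (0 : (Fin m × Fin n) →₀ ℕ) := by constructor <;> simp
  obtain ⟨φ, hφI, hφ, -⟩ := h0.exists_functional (k := k) hm hmn
  exact hφ (hφI _ (h ▸ Submodule.mem_top))

theorem isStronglyKoszul_maximalMinorApolarIdeal (hm : 0 < m) (hmn : m ≤ n) :
    IsStronglyKoszul k (quotientGrading (maximalMinorApolarIdeal k m n))
      (fun v : Fin m × Fin n => Ideal.Quotient.mk (maximalMinorApolarIdeal k m n) (X v)) where
  standardGraded := isStandardGraded_quotientGrading (maximalMinorApolarIdeal_ne_top hm hmn)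
    fun _ hf d => homogeneousComponent_mem_maximalMinorApolarIdeal hf d
  linearIndependent := linearIndependent_mk_X hm hmn
  span_eq := (quotientGrading_one _).symm
  colon_eq := by
    rintro A ⟨s, t⟩ hst
    have himage : ∀ B : Set (Fin m × Fin n),
        Ideal.span ((fun v => Ideal.Quotient.mk (maximalMinorApolarIdeal k m n) (X v)) '' B) =
          (Ideal.span (X '' B)).map (Ideal.Quotient.mk (maximalMinorApolarIdeal k m n)) := by
      intro B
      rw [Ideal.map_span, Set.image_image]
    refine ⟨{v | X v * X (s, t) ∈ Ideal.span (X '' A) ⊔ maximalMinorApolarIdeal k m n}, ?_⟩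
    ext x
    obtain ⟨f, rfl⟩ := Ideal.Quotient.mk_surjective x
    rw [Submodule.mem_colon_singleton, smul_eq_mul, ← map_mul, himage, himage,
      Ideal.mem_quotient_iff_mem_sup, Ideal.mem_quotient_iff_mem_sup]
    exact mul_X_mem_span_X_sup_iff hm hmn hst f

end Colon

theorem mainTheorem7 (k : Type*) [Field k] (m n : ℕ) (hm : 0 < m) (hmn : m ≤ n) :
    (∀ f ∈ genericQuadrics k m n, IsTidy f ∧ IsQuadric f) ∧
    IsRevLexUniversalGroebnerBasis (genericQuadrics k m n) (maximalMinorApolarIdeal k m n) ∧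
    (genericQuadrics k m n).ncard = (m + 1).choose 2 * (n + 1).choose 2 ∧
    IsStronglyKoszul k (quotientGrading (maximalMinorApolarIdeal k m n))
      (fun v : Fin m × Fin n =>
        Ideal.Quotient.mk (maximalMinorApolarIdeal k m n) (MvPolynomial.X v)) := by
  refine ⟨fun f hf => ?_, isRevLexUniversalGroebnerBasis_genericQuadrics hm hmn,
    ncard_genericQuadrics k m n, isStronglyKoszul_maximalMinorApolarIdeal hm hmn⟩
  obtain ⟨i, j, p, q, rfl⟩ := (mem_genericQuadrics_iff k f).1 hf
  exact ⟨isTidy_quadric k i j p q, quadric_ne_zero k i j p q, isHomogeneous_quadric k i j p q⟩
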